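/- A spherical tangle diagram $S$ is a diagram, drawn in a planar annulus with finitely many transversal double points (crossings) carrying over/under information, of a compact proper $1$-dimensional submanifold having exactly four endpoints on each of the two boundary circles, at the positions NE, NW, SW, SE. For $i,j\in\{1,2\}$ let $S_{ij}$ be the link diagram obtained from $S$ by - joining, outside the annulus, the outer endpoints by two disjoint arcs, NW with NE and SW with SE if $i=1$ (numerator closure), NW with SW and NE with SE if $i=2$ (denominator closure), and - filling the inner disc with two disjoint arcs joining the inner endpoints, NW with SW and NE with SE if $j=1$ (fundamental tangle $1$), NW with NE and SW with SE if $j=2$ (fundamental tangle $2$). For a link diagram $L$ let $$\langle L\rangle=\sum_{\sigma}A^{\alpha(\sigma)-\beta(\sigma)}\,(-A^2-A^{-2})^{d(\sigma)-1},\qquad A=e^{i\pi/4},$$ be its Kauffman bracket at $A=e^{i\pi/4}$ (with $0^0=1$). Here $\sigma$ runs over all choices of an $A$-type or $B$-type splitting at each crossing, $\alpha(\sigma)$ and $\beta(\sigma)$ are the numbers of $A$-type and of $B$-type splittings, and $d(\sigma)$ is the number of circles of the resulting crossingless diagram. The $A$-type splitting at a crossing opens a channel between the two regions swept out by rotating the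 over-strand counterclockwise, and the $B$-type splitting opens a channel between the other two regions. Put $$F(S)=\left\{\,z\begin{pmatrix}\langle S_{11}\rangle & -i\langle S_{12}\rangle\\ i\langle S_{21}\rangle & \langle S_{22}\rangle\end{pmatrix}\ :\ z\in\mathbb C,\ z^8=1\right\}\cap M_{2\times2}(\mathbb Z),$$ and for $M\in M_{2\times 2}(\mathbb Z)$ write $[M]=\{M,-M\}$. **Theorem.** Let $S$ be a spherical tangle diagram that has a closed component (a component that is a circle). Then $F(S)=[M]$ for some $M\in M_{2\times2}(\mathbb Z)$, and whenever $F(S)=\left[\begin{smallmatrix}\alpha&\gamma\\ \beta&\delta\end{smallmatrix}\right]$ with $\alpha,\beta,\gamma,\delta\in\mathbb Z$, we have $$\alpha\equiv\beta\equiv\gamma\equiv\delta\equiv 0\pmod 2 .$$ -/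

import Mathlib

/-! Link diagrams and spherical tangle diagrams are described by their combinatorial maps: a diagram
is a graph drawn on the oriented 2-sphere, and it is recorded by its darts (half-edges), by the
involution matching the two halves of every edge, and by the cyclic counterclockwise order of the
darts around every vertex. The vertices are

* the crossings (4-valent),
* auxiliary 2-valent points lying on the strands (so that also a circle without crossings is
  made of darts),
* for tangle diagrams, the boundary circles (4-valent), each shrunk to one vertex.

The map is drawn on the sphere exactly when Euler's formula holds on each of its connected parts. -/

/-- The number of classes of the equivalence relation generated by `a ∼ f a`. -/
noncomputable def orbitCount {D : Type*} (f : D → D) : ℕ :=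
  Nat.card (Quot fun a b : D => b = f a)

/-- The number of classes of the equivalence relation generated by `a ∼ f a` and `a ∼ g a`. -/
noncomputable def orbitCount₂ {D : Type*} (f g : D → D) : ℕ :=
  Nat.card (Quot fun a b : D => b = f a ∨ b = g a)

/-- Four points `0, 1, 2, 3` in counterclockwise order on a circle; this pairs `0` with `1` and
`2` with `3`. -/
def pairing01 (k : ZMod 4) : ZMod 4 := 1 - k

/-- Four points `0, 1, 2, 3` in counterclockwise order on a circle; this pairs `1` with `2` and
`3` with `0`. -/
def pairing12 (k : ZMod 4) : ZMod 4 := 3 - k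

/-- The data of a link diagram with set of crossings `X` that enter the Kauffman bracket.

The dart `Sum.inl (x, k)` is the `k`-th of the four arcs leaving the crossing `x`; they are numbered
counterclockwise, and `0, 2` form the over-strand while `1, 3` form the under-strand.
The darts `Sum.inr j` come in pairs `j, pass j` and are the two sides of the 2-valent points.
The map `glue` matches the two halves of every edge.
(The bracket is a function of these data; planarity is not needed to define it.) -/
structure LinkCode (X J : Type*) where
  pass : J → J
  pass_pass : ∀ j, pass (pass j) = j
  pass_ne : ∀ j, pass j ≠ j
  glue : (X × ZMod 4) ⊕ J → (X × ZMod 4) ⊕ J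
  glue_glue : ∀ d, glue (glue d) = d
  glue_ne : ∀ d, glue d ≠ d

namespace LinkCode

variable {X J : Type*}

/-- How the darts are joined at the vertices after splitting the crossings according to the
state `σ`, where `true` is the A-type and `false` the B-type splitting. Rotating the over-strand
`0, 2` counterclockwise sweeps out the regions between `0, 1` and between `2, 3`: these are the
A-regions. The A-type splitting opens a channel between them, so it joins `1` to `2` and
`3` to `0`; the B-type splitting joins `0` to `1` and `2` to `3`. -/
def split (L : LinkCode X J) (σ : X → Bool) : (X × ZMod 4) ⊕ J → (X × ZMod 4) ⊕ J
  | Sum.inl (x, k) => Sum.inl (x, if σ x = true then pairing12 k else pairing01 k)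
  | Sum.inr j => Sum.inr (L.pass j)

/-- The number `d(σ)` of circles of the diagram obtained by splitting all crossings along `σ`. -/
noncomputable def circles (L : LinkCode X J) (σ : X → Bool) : ℕ :=
  orbitCount₂ L.glue (L.split σ)

/-- The Kauffman bracket
`∑ σ, A ^ α(σ) * (A⁻¹) ^ β(σ) * (-A ^ 2 - A ^ (-2)) ^ (d(σ) - 1)` (with `d(σ) ≥ 1` for every
nonempty diagram). -/
noncomputable def bracket [Fintype X] (L : LinkCode X J) (A : ℂ) : ℂ :=
  open Classical in
  ∑ σ : X → Bool,
    A ^ (Finset.univ.filter fun x => σ x = true).card *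
      A⁻¹ ^ (Finset.univ.filter fun x => σ x = false).card *
      (-A ^ 2 - A⁻¹ ^ 2) ^ (L.circles σ - 1)

end LinkCode

/-- The two boundary circles of the annulus in which a spherical tangle diagram is drawn. -/
inductive Hole
  | outer
  | inner

/-- The darts of a spherical tangle diagram: those at crossings and at 2-valent points as for links,
and the darts starting at the endpoint number `k` of a boundary circle. In the plane the four
endpoints on either boundary circle are numbered counterclockwise:
`0` is NE, `1` is NW, `2` is SW, `3` is SE. -/
abbrev SDart (X J : Type*) : Type _ := (X × ZMod 4) ⊕ (J ⊕ (Hole × ZMod 4))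

/-- The next dart counterclockwise around the same vertex, on the oriented sphere in which both
boundary circles of the annulus are shrunk to points. Around the outer boundary
circle, which bounds the disc containing the point at infinity, the counterclockwise order of
the sphere is the clockwise order of the plane. -/
def nextDart {X J : Type*} (pass : J → J) : SDart X J → SDart X J
  | Sum.inl (x, k) => Sum.inl (x, k + 1)
  | Sum.inr (Sum.inl j) => Sum.inr (Sum.inl (pass j))
  | Sum.inr (Sum.inr (Hole.inner, k)) => Sum.inr (Sum.inr (Hole.inner, k + 1))
  | Sum.inr (Sum.inr (Hole.outer, k)) => Sum.inr (Sum.inr (Hole.outer, k - 1))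

/-- A spherical tangle diagram: a diagram, in an annulus in the plane, of a proper 1-dimensional
submanifold with four endpoints on each of the two boundary circles. `X` is the set of crossings,
numbered darts and over/under information are as in `LinkCode`, and `J` is the set of darts at
2-valent points. The field `planar` is Euler's formula
`#vertices + #faces = #edges + 2 * #(connected parts)`. -/
structure SphericalTangle (X J : Type*) where
  pass : J → J
  pass_pass : ∀ j, pass (pass j) = j
  pass_ne : ∀ j, pass j ≠ j
  glue : SDart X J → SDart X J
  glue_glue : ∀ d, glue (glue d) = d
  glue_ne : ∀ d, glue d ≠ d
  planar : orbitCount (nextDart (X := X) pass) + orbitCount (fun d => nextDart pass (glue d)) =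
    orbitCount glue + 2 * orbitCount₂ glue (nextDart pass)

namespace SphericalTangle

variable {X J : Type*}

/-- Walk straight through a vertex; the strands end at the boundary circles. -/
def through (S : SphericalTangle X J) : SDart X J → SDart X J
  | Sum.inl (x, k) => Sum.inl (x, k + 2)
  | Sum.inr (Sum.inl j) => Sum.inr (Sum.inl (S.pass j))
  | Sum.inr (Sum.inr e) => Sum.inr (Sum.inr e)

/-- The components (arcs and circles) of the tangle. -/
def Component (S : SphericalTangle X J) : Type _ :=
  Quot fun a b : SDart X J => b = S.glue a ∨ b = S.through a

/-- The component containing a given dart. -/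
def component (S : SphericalTangle X J) (d : SDart X J) : S.Component := Quot.mk _ d

/-- A component is closed if it contains no endpoint of the tangle. -/
def Component.IsClosed (S : SphericalTangle X J) (c : S.Component) : Prop :=
  ∀ e : Hole × ZMod 4, S.component (Sum.inr (Sum.inr e)) ≠ c

/-- How the endpoints are joined in the link `S_{ij}`; the values `0, 1` of `i, j` stand
for the indices `1, 2`. Outside, the numerator closure (`i = 0`) joins NW to NE and SW to SE, the
denominator closure (`i = 1`) joins NW to SW and NE to SE. Inside, the hole is filled by the
fundamental tangle `1` (`j = 0`), which joins NW to SW and NE to SE, or by the fundamental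
tangle `2` (`j = 1`), which joins NW to NE and SW to SE. -/
def closing (i j : Fin 2) : Hole × ZMod 4 → Hole × ZMod 4
  | (Hole.outer, k) => (Hole.outer, if i = 0 then pairing01 k else pairing12 k)
  | (Hole.inner, k) => (Hole.inner, if j = 0 then pairing12 k else pairing01 k)

theorem closing_closing (i j : Fin 2) (e : Hole × ZMod 4) :
    closing i j (closing i j e) = e := by
  obtain ⟨h, k⟩ := e
  cases h <;> simp only [closing, pairing01, pairing12] <;> split_ifs <;> simp

theorem closing_ne (i j : Fin 2) (e : Hole × ZMod 4) : closing i j e ≠ e := by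
  obtain ⟨h, k⟩ := e
  have h1 : ∀ k : ZMod 4, 1 - k ≠ k := by decide
  have h3 : ∀ k : ZMod 4, 3 - k ≠ k := by decide
  cases h <;> simp only [closing, pairing01, pairing12] <;> split_ifs <;> simp [h1, h3]

/-- The link diagram `S_{ij}`: the eight endpoints of the tangle become sides of 2-valent points, at
which they are joined in pairs by the closing arcs. -/
def close (S : SphericalTangle X J) (i j : Fin 2) : LinkCode X (J ⊕ (Hole × ZMod 4)) where
  pass := Sum.map S.pass (closing i j)
  pass_pass := by
    rintro (a | e)
    · simp [S.pass_pass]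
    · simp [closing_closing]
  pass_ne := by
    rintro (a | e)
    · simpa using S.pass_ne a
    · simpa using closing_ne i j e
  glue := S.glue
  glue_glue := S.glue_glue
  glue_ne := S.glue_ne

/-- The Kauffman bracket of `S_{ij}` at `A = e^{iπ/4}`. -/
noncomputable def closureBracket [Fintype X] (S : SphericalTangle X J) (i j : Fin 2) : ℂ :=
  (S.close i j).bracket (Complex.exp (Real.pi / 4 * Complex.I))

/-- The matrix with rows `⟨S₁₁⟩, -i ⟨S₁₂⟩` and `i ⟨S₂₁⟩, -i · i ⟨S₂₂⟩`. -/
noncomputable def bracketMatrix [Fintype X] (S : SphericalTangle X J) : Matrix (Fin 2) (Fin 2) ℂ :=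
  !![S.closureBracket 0 0, -Complex.I * S.closureBracket 0 1;
    Complex.I * S.closureBracket 1 0, -Complex.I * (Complex.I * S.closureBracket 1 1)]

/-- The invariant `F(S)`: all integer matrices of the form `z • bracketMatrix S`
with `z` an eighth root of unity. -/
def invariant [Fintype X] (S : SphericalTangle X J) : Set (Matrix (Fin 2) (Fin 2) ℤ) :=
  {M | ∃ z : ℂ, z ^ 8 = 1 ∧ M.map (Int.cast : ℤ → ℂ) = z • S.bracketMatrix}

end SphericalTangle

/-- The element `[M] = {M, -M}` of `PM_{2×2}(ℤ)`, the integer `2 × 2` matrices modulo `±1`. -/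
def projClass (M : Matrix (Fin 2) (Fin 2) ℤ) : Set (Matrix (Fin 2) (Fin 2) ℤ) := {M, -M}

/-! At `A = e^{iπ/4}` the loop value `-A^2 - A^{-2}` is zero, so only states with a single circle
contribute: with `n` crossings, the bracket is `A^{-n}` times the sum of `i^{α(σ)}` over these
states (`LinkCode.bracket_eq_sum`). Two independent facts about one-circle states then give the
theorem.

Parity: treat the closings at the two boundary circles as further splittings. Euler's formula gives
a checkerboard colouring of the faces (`exists_checkerboard`), which makes the circles of every
state alternate in colour. Following a circle for two steps permutes the darts of colour 0. Changing
one splitting multiplies this permutation by a transposition, while a single circle makes it a full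
cycle. Hence the total number of A-splittings has the same parity in all one-circle states
(`exists_sign_of_oneCircle`). The factors `-i` and `i` in the matrix compensate for the closings, so
all entries are integers times one common eighth root of unity, each integer being a sum of signs
over one-circle states.

Evenness: modulo 2 such an integer counts one-circle states. This count obeys a skein relation, by
which the two splittings of a crossing together count as much as passing straight through it.
Removing all crossings in this way leaves 1 for a knot and 0 otherwise (`sum_oneCircleIndicator`),
and a closed component excludes a knot. -/

/-! ### Checkerboard colourings from Euler's formula, by linear algebra over `ZMod 2` -/

/-- The functions to `ZMod 2` that are constant on the classes generated by `r`. -/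
def invariantFunctions {D : Type*} (r : D → D → Prop) : Submodule (ZMod 2) (D → ZMod 2) where
  carrier := {f | ∀ a b, r a b → f a = f b}
  add_mem' hf hg a b h := by simp [hf a b h, hg a b h]
  zero_mem' _ _ _ := rfl
  smul_mem' z f hf a b h := by simp [hf a b h]

/-- Invariant functions are the functions on the quotient. -/
def invariantFunctionsEquiv {D : Type*} (r : D → D → Prop) :
    invariantFunctions r ≃ₗ[ZMod 2] (Quot r → ZMod 2) where
  toFun f := Quot.lift f.1 f.2
  map_add' f g := by ext ⟨a⟩; rfl
  map_smul' z f := by ext ⟨a⟩; rfl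
  invFun q := ⟨fun a => q (Quot.mk r a), fun _ _ h => congrArg q (Quot.sound h)⟩
  left_inv f := rfl
  right_inv q := by ext ⟨a⟩; rfl

theorem finrank_invariantFunctions {D : Type*} [Finite D] (r : D → D → Prop) :
    Module.finrank (ZMod 2) (invariantFunctions r) = Nat.card (Quot r) := by
  have : Fintype (Quot r) := Fintype.ofFinite _
  rw [(invariantFunctionsEquiv r).finrank_eq, Module.finrank_fintype_fun_eq_card,
    Nat.card_eq_fintype_card]

/-- A class of an involution has the form `{a, g a}`. Only this inequality is needed in the
dimension count for the colouring. -/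
theorem card_le_two_mul_orbitCount {D : Type*} [Fintype D] (g : D → D)
    (hg : ∀ d, g (g d) = d) : Fintype.card D ≤ 2 * orbitCount g := by
  classical
  have : Fintype (Quot fun a b : D => b = g a) := Fintype.ofFinite _
  rw [orbitCount, Nat.card_eq_fintype_card, ← Finset.card_univ, ← Finset.card_univ]
  refine Finset.card_le_mul_card_image_of_maps_to
    (f := fun a => Quot.mk (fun a b : D => b = g a) a) (fun _ _ => Finset.mem_univ _) 2 ?_
  rintro ⟨a⟩ -
  refine (Finset.card_le_card (t := {a, g a}) ?_).trans Finset.card_le_two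
  intro b hb
  let f : (Quot fun a b : D => b = g a) → Prop := Quot.lift (fun b => b = a ∨ b = g a) (by
    rintro b _ rfl
    have := hg b
    have := hg a
    grind)
  have h : f (Quot.mk _ b) = f (Quot.mk _ a) := congrArg f (Finset.mem_filter.1 hb).2
  have h' : (b = a ∨ b = g a) = (a = a ∨ a = g a) := h
  simpa using h'

theorem zmod_two_add_self (a : ZMod 2) : a + a = 0 := CharTwo.add_self_eq_zero a

/-- Sums over `ZMod 2` of functions invariant under an involution without fixed points vanish. -/
theorem sum_eq_zero_of_involution {D : Type*} [Fintype D] (t : D → D) (ht : ∀ d, t (t d) = d)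
    (hne : ∀ d, t d ≠ d) (f : D → ZMod 2) (hf : ∀ d, f (t d) = f d) : ∑ d, f d = 0 :=
  Finset.sum_involution (fun d _ => t d) (fun d _ => by rw [hf, zmod_two_add_self])
    (fun d _ _ => hne d) (fun _ _ => Finset.mem_univ _) (fun d _ => ht d)

/-- On a map satisfying Euler's formula all of whose vertices are even, the faces can be coloured
with two colours such that faces sharing an edge have different colours. -/
theorem exists_checkerboard {D : Type*} [Fintype D] (n g : D → D) (hn : Function.Bijective n)
    (hg : ∀ d, g (g d) = d) (hne : ∀ d, g d ≠ d)
    (heven : ∀ h : D → ZMod 2, (∀ d, h (n d) = h d) → ∑ d, h d = 0)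
    (euler : orbitCount n + orbitCount (fun d => n (g d)) = orbitCount g + 2 * orbitCount₂ g n) :
    ∃ f : D → ZMod 2, (∀ d, f (n d) = f d + 1) ∧ ∀ d, f (g d) = f d + 1 := by
  classical
  set V := invariantFunctions (fun a b : D => b = n a)
  set E := invariantFunctions (fun a b : D => b = g a)
  set F := invariantFunctions (fun a b : D => b = n (g a))
  set C := invariantFunctions (fun a b : D => b = g a ∨ b = n a)
  have dV : Module.finrank (ZMod 2) V = orbitCount n := finrank_invariantFunctions _
  have dE : Module.finrank (ZMod 2) E = orbitCount g := finrank_invariantFunctions _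
  have dF : Module.finrank (ZMod 2) F = orbitCount (fun d => n (g d)) :=
    finrank_invariantFunctions _
  have dC : Module.finrank (ZMod 2) C = orbitCount₂ g n := finrank_invariantFunctions _
  have mV : ∀ f : D → ZMod 2, f ∈ V ↔ ∀ d, f (n d) = f d := fun f =>
    ⟨fun h d => (h d _ rfl).symm, fun h a b e => by rw [e, h]⟩
  have mE : ∀ f : D → ZMod 2, f ∈ E ↔ ∀ d, f (g d) = f d := fun f =>
    ⟨fun h d => (h d _ rfl).symm, fun h a b e => by rw [e, h]⟩
  have mF : ∀ f : D → ZMod 2, f ∈ F ↔ ∀ d, f (n (g d)) = f d := fun f =>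
    ⟨fun h d => (h d _ rfl).symm, fun h a b e => by rw [e, h]⟩
  have mC : ∀ f : D → ZMod 2, f ∈ C ↔ (∀ d, f (g d) = f d) ∧ ∀ d, f (n d) = f d := fun f =>
    ⟨fun h => ⟨fun d => (h d _ (Or.inl rfl)).symm, fun d => (h d _ (Or.inr rfl)).symm⟩,
      fun h a b e => by rcases e with e | e <;> simp [e, h.1, h.2]⟩
  have hVE : V ⊓ E = C := by
    ext f; rw [Submodule.mem_inf, mV, mE, mC, and_comm]
  -- The coboundary from faces to edges: it compares the values on the two sides of an edge, and its
  -- kernel on `F` is `C`.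
  let T : (D → ZMod 2) →ₗ[ZMod 2] (D → ZMod 2) := LinearMap.id + LinearMap.funLeft _ _ g
  have hT : ∀ f d, T f d = f d + f (g d) := fun _ _ => rfl
  have hker : (LinearMap.ker (T.domRestrict F)).map F.subtype = C := by
    ext f
    rw [mC]
    constructor
    · rintro ⟨⟨f, hf⟩, hk, rfl⟩
      rw [mF] at hf
      have h1 : ∀ d, f (g d) = f d := fun d => by
        have := congrFun (LinearMap.mem_ker.1 hk) d
        exact (CharTwo.add_eq_zero.1 this).symm
      refine ⟨h1, fun d => ?_⟩
      have := hf (g d)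
      rw [hg] at this
      exact this.trans (h1 d)
    · rintro ⟨h1, h2⟩
      refine ⟨⟨f, (mF f).2 fun d => by rw [h2, h1]⟩, ?_, rfl⟩
      refine LinearMap.mem_ker.2 (funext fun d => ?_)
      exact CharTwo.add_eq_zero.2 (h1 d).symm
  have rT := LinearMap.finrank_range_add_finrank_ker (T.domRestrict F)
  rw [← Submodule.finrank_map_subtype_eq, hker] at rT
  set U := LinearMap.range (T.domRestrict F)
  let B : LinearMap.BilinForm (ZMod 2) (D → ZMod 2) := Matrix.toBilin' 1
  have hB : ∀ f h, B f h = ∑ d, f d * h d := fun f h => by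
    simp [B, Matrix.toBilin'_apply', dotProduct]
  have Bnd : B.Nondegenerate := by
    exact Matrix.nondegenerate_toBilin'_iff.2 (Matrix.nondegenerate_of_det_ne_zero (by simp))
  have hW := LinearMap.BilinForm.finrank_orthogonal Bnd (V ⊔ E)
  have hsum := Submodule.finrank_sup_add_finrank_inf_eq V E
  rw [hVE] at hsum
  rw [Module.finrank_fintype_fun_eq_card] at hW
  have hcard := card_le_two_mul_orbitCount g hg
  have mW : ∀ u : D → ZMod 2, (∀ v ∈ V, ∑ d, v d * u d = 0) → (∀ e ∈ E, ∑ d, e d * u d = 0) →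
      u ∈ B.orthogonal (V ⊔ E) := by
    intro u h1 h2 m hm
    obtain ⟨v, hv, e, he, rfl⟩ := Submodule.mem_sup.1 hm
    change B (v + e) u = 0
    rw [map_add, LinearMap.add_apply, hB, hB, h1 v hv, h2 e he,
      add_zero]
  have hUW : U ≤ B.orthogonal (V ⊔ E) := by
    rintro _ ⟨⟨f, hf⟩, rfl⟩
    rw [mF] at hf
    have hf' : ∀ d, f (g d) = f (n d) := fun d => by rw [← hf (g d), hg]
    refine mW _ (fun v hv => ?_) (fun e he => ?_)
    · rw [mV] at hv
      have : ∑ d, v (n d) * f (n d) = ∑ d, v d * f d :=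
        hn.sum_comp (fun d => v d * f d)
      calc ∑ d, v d * T f d = ∑ d, v d * f d + ∑ d, v (n d) * f (n d) := by
            rw [← Finset.sum_add_distrib]
            exact Finset.sum_congr rfl fun d _ => by rw [hT, mul_add, hv, hf']
        _ = 0 := by rw [this, zmod_two_add_self]
    · rw [mE] at he
      refine sum_eq_zero_of_involution g hg hne _ fun d => ?_
      change e (g d) * T f (g d) = e d * T f d
      rw [hT, hT, hg, he, add_comm]
  -- `U` has dimension faces minus parts, and the orthogonal complement has dimension `|D|` minus
  -- vertices minus edges plus parts. Euler's formula and `|D| ≤ 2 * edges` compare the two, so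
  -- coboundaries fill the complement.
  have hle : Module.finrank (ZMod 2) (B.orthogonal (V ⊔ E)) ≤ Module.finrank (ZMod 2) U := by
    omega
  have hone : (1 : D → ZMod 2) ∈ B.orthogonal (V ⊔ E) := by
    refine mW _ (fun v hv => ?_) (fun e he => ?_)
    · simpa using heven v ((mV v).1 hv)
    · simpa using sum_eq_zero_of_involution g hg hne e ((mE e).1 he)
  -- The constant 1 is therefore a coboundary: some face function changes across every edge.
  rw [← Submodule.eq_of_le_of_finrank_le hUW hle] at hone
  obtain ⟨⟨f, hf⟩, h1⟩ := hone
  rw [mF] at hf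
  have h2 : ∀ d, f (g d) = f d + 1 := fun d => by
    have h : f d + f (g d) = 1 := congrFun h1 d
    rw [← h, ← add_assoc, zmod_two_add_self, zero_add]
  refine ⟨f, fun d => ?_, h2⟩
  rw [← h2, ← hf (g d), hg]

/-! ### Skein relation modulo 2 for one-circle states -/

/-- A map all of whose vertices are 2-valent except for the 1-valent ends at four points is not
connected. -/
theorem exists_not_constant_of_four_ends {D : Type*} [Fintype D] (g s : D → D)
    (hg : ∀ d, g (g d) = d) (hs : ∀ d, s (s d) = d) (P : Finset D) (hP : P.card = 4)
    (hsP : ∀ d, d ∉ P → s d ∉ P) :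
    ∃ f : D → ZMod 2, (∀ d, f (g d) = f d) ∧ (∀ d, d ∉ P → f (s d) = f d) ∧
      ∃ a b, f a ≠ f b := by
  classical
  let G : SimpleGraph D :=
    { Adj := fun a b => a ≠ b ∧ (b = g a ∨ (b = s a ∧ a ∉ P))
      symm := ⟨by
        rintro a b ⟨h1, rfl | ⟨rfl, h2⟩⟩
        · exact ⟨h1.symm, Or.inl (hg a).symm⟩
        · exact ⟨h1.symm, Or.inr ⟨(hs a).symm, hsP a h2⟩⟩⟩
      loopless := ⟨fun a h => h.1 rfl⟩ }
  have hadj : ∀ a b, G.Adj a b ↔ a ≠ b ∧ (b = g a ∨ (b = s a ∧ a ∉ P)) := fun _ _ => Iff.rfl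
  have hG : ¬ G.Preconnected := by
    intro hpre
    have : Nonempty D := by
      obtain ⟨d, -⟩ := Finset.card_pos.1 (by omega : 0 < P.card)
      exact ⟨d⟩
    have hc : G.Connected := ⟨hpre⟩
    have h1 := hc.card_vert_le_card_edgeSet_add_one
    rw [Nat.card_eq_fintype_card, Nat.card_eq_fintype_card, ← SimpleGraph.edgeFinset_card] at h1
    have h2 := G.sum_degrees_eq_twice_card_edges
    -- The degrees sum to at most `2 * |D| - 4`, so there are at most `|D| - 2` edges, one too few
    -- for a connected graph.
    have h3 : ∀ d, G.degree d + (if d ∈ P then 1 else 0) ≤ 2 := by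
      intro d
      by_cases hd : d ∈ P
      · have : G.neighborFinset d ⊆ {g d} := fun b hb => by
          rw [SimpleGraph.mem_neighborFinset, hadj] at hb
          simp [hd] at hb
          simp [hb.2]
        have := Finset.card_le_card this
        rw [SimpleGraph.card_neighborFinset_eq_degree, Finset.card_singleton] at this
        simp [hd]; omega
      · have : G.neighborFinset d ⊆ {g d, s d} := fun b hb => by
          rw [SimpleGraph.mem_neighborFinset, hadj] at hb
          simp only [Finset.mem_insert, Finset.mem_singleton]
          tauto
        have := (Finset.card_le_card this).trans Finset.card_le_two
        rw [SimpleGraph.card_neighborFinset_eq_degree] at this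
        simp [hd]; omega
    have h4 := Finset.sum_le_sum fun d (_ : d ∈ Finset.univ) => h3 d
    rw [Finset.sum_add_distrib, Finset.sum_boole, Finset.sum_const, Finset.card_univ,
      Finset.filter_univ_mem] at h4
    simp only [smul_eq_mul, Nat.cast_id] at h4
    omega
  simp only [SimpleGraph.Preconnected, not_forall] at hG
  obtain ⟨u, v, huv⟩ := hG
  have key : ∀ a b, b = g a ∨ (b = s a ∧ a ∉ P) → (G.Reachable u b ↔ G.Reachable u a) := by
    intro a b h
    by_cases hab : a = b
    · rw [hab]
    · have h' : G.Reachable a b := SimpleGraph.Adj.reachable ⟨hab, h⟩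
      exact ⟨fun e => e.trans h'.symm, fun e => e.trans h'⟩
  refine ⟨fun d => if G.Reachable u d then 1 else 0, fun d => ?_, fun d hd => ?_, u, v, ?_⟩
  · simp only [key d (g d) (Or.inl rfl)]
  · simp only [key d (s d) (Or.inr ⟨rfl, hd⟩)]
  · simp [huv]

/-- The three pairings of the four darts at a crossing: going straight through (`none`),
and the A-type and B-type splittings. -/
def turn : Option Bool → ZMod 4 → ZMod 4
  | none, k => k + 2
  | some true, k => pairing12 k
  | some false, k => pairing01 k

theorem turn_turn (o : Option Bool) (k : ZMod 4) : turn o (turn o k) = k := by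
  revert o k; decide

theorem turn_ne (o : Option Bool) (k : ZMod 4) : turn o k ≠ k := by
  revert o k; decide

/-- A function on four points with vanishing sum is invariant under some pairing. -/
theorem exists_turn_invariant (v : ZMod 4 → ZMod 2) (hv : ∑ k, v k * v k = 0) :
    ∃ o, ∀ k, v (turn o k) = v k := by
  revert v; decide

/-- Functions on four points orthogonal to each other and invariant under two different
pairings. -/
theorem turn_invariant_of_orthogonal (v w : ZMod 4 → ZMod 2) (hvw : ∑ k, v k * w k = 0)
    (o₁ o₂ o₃ : Option Bool) (h₁₂ : o₁ ≠ o₂) (h₁ : ∀ k, v (turn o₁ k) = v k)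
    (h₂ : ∀ k, w (turn o₂ k) = w k) :
    (∀ k, v (turn o₃ k) = v k) ∨ ∀ k, w (turn o₃ k) = w k := by
  -- If neither function were constant, their supports would be pairs from two different pairings;
  -- these meet in exactly one point, contradicting orthogonality.
  have hv : (∀ k, v k = v 0) ∨ (∀ k, w k = w 0) := by
    clear o₃
    revert v w o₁ o₂
    decide
  rcases hv with h | h
  · left; intro k; rw [h, h k]
  · right; intro k; rw [h, h k]

namespace LinkCode

variable {X J : Type*}

/-- How the darts are joined at the vertices if the crossing `x` is replaced by the pairing
`turn (p x)`. -/
def join (L : LinkCode X J) (p : X → Option Bool) : (X × ZMod 4) ⊕ J → (X × ZMod 4) ⊕ J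
  | Sum.inl (x, k) => Sum.inl (x, turn (p x) k)
  | Sum.inr j => Sum.inr (L.pass j)

theorem join_join (L : LinkCode X J) (p : X → Option Bool) (d : (X × ZMod 4) ⊕ J) :
    L.join p (L.join p d) = d := by
  rcases d with ⟨x, k⟩ | j
  · simp [join, turn_turn]
  · simp [join, L.pass_pass]

theorem join_ne (L : LinkCode X J) (p : X → Option Bool) (d : (X × ZMod 4) ⊕ J) :
    L.join p d ≠ d := by
  rcases d with ⟨x, k⟩ | j
  · simp [join, turn_ne]
  · simp [join, L.pass_ne]

theorem join_some (L : LinkCode X J) (σ : X → Bool) :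
    L.join (fun x => some (σ x)) = L.split σ := by
  funext d
  rcases d with ⟨x, k⟩ | j
  · simp only [join, split]
    cases σ x <;> rfl
  · rfl

/-- The darts form a single circle if the crossings are replaced by the pairings `p`. -/
def OneCircle (L : LinkCode X J) (p : X → Option Bool) : Prop :=
  ∀ f : (X × ZMod 4) ⊕ J → ZMod 2, (∀ d, f (L.glue d) = f d) → (∀ d, f (L.join p d) = f d) →
    ∀ a b, f a = f b

/-- Functions that are constant on the circles and arcs of the diagram with the crossing `x` removed
and the other crossings replaced by the pairings `p`. -/
def InvariantOff (L : LinkCode X J) (p : X → Option Bool) (x : X)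
    (f : (X × ZMod 4) ⊕ J → ZMod 2) : Prop :=
  (∀ d, f (L.glue d) = f d) ∧ ∀ d, (∀ k, d ≠ Sum.inl (x, k)) → f (L.join p d) = f d

theorem oneCircle_update_iff [DecidableEq X] (L : LinkCode X J) (p : X → Option Bool) (x : X)
    (o : Option Bool) : L.OneCircle (Function.update p x o) ↔
      ∀ f, L.InvariantOff p x f → (∀ k, f (Sum.inl (x, turn o k)) = f (Sum.inl (x, k))) →
        ∀ a b, f a = f b := by
  have h : ∀ f : (X × ZMod 4) ⊕ J → ZMod 2,
      (∀ d, f (L.join (Function.update p x o) d) = f d) ↔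
      (∀ d, (∀ k, d ≠ Sum.inl (x, k)) → f (L.join p d) = f d) ∧
        ∀ k, f (Sum.inl (x, turn o k)) = f (Sum.inl (x, k)) := by
    intro f
    constructor
    · intro hf
      refine ⟨fun d hd => ?_, fun k => ?_⟩
      · rw [← hf d]
        rcases d with ⟨y, k⟩ | j
        · have hy : y ≠ x := by rintro rfl; exact hd k rfl
          simp [join, hy]
        · rfl
      · simpa [join] using hf (Sum.inl (x, k))
    · rintro ⟨h1, h2⟩ (⟨y, k⟩ | j)
      · by_cases hy : y = x
        · subst hy; simpa [join] using h2 k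
        · have := h1 (Sum.inl (y, k)) (by simp [hy])
          simpa [join, hy] using this
      · exact h1 (Sum.inr j) (by simp)
  constructor
  · intro H f hf hk
    exact H f hf.1 ((h f).2 ⟨hf.2, hk⟩)
  · intro H f hg hf
    exact H f ⟨hg, ((h f).1 hf).1⟩ ((h f).1 hf).2

/-- The product sums to zero over all darts, which `glue` pairs off, and over the darts away from
`x`, which `join` pairs off. The difference is the sum over the four darts at `x`. -/
theorem sum_mul_eq_zero_of_invariantOff [Fintype X] [Fintype J] (L : LinkCode X J)
    (p : X → Option Bool) (x : X) (f h : (X × ZMod 4) ⊕ J → ZMod 2) (hf : L.InvariantOff p x f)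
    (hh : L.InvariantOff p x h) :
    ∑ k, f (Sum.inl (x, k)) * h (Sum.inl (x, k)) = 0 := by
  classical
  have h1 : ∑ d, f d * h d = 0 :=
    sum_eq_zero_of_involution L.glue L.glue_glue L.glue_ne _ fun d => by rw [hf.1, hh.1]
  let φ : (X × ZMod 4) ⊕ J → ZMod 2 := Sum.elim
    (fun y => if y.1 = x then 0 else f (Sum.inl y) * h (Sum.inl y))
    (fun j => f (Sum.inr j) * h (Sum.inr j))
  have h2 : ∑ d, φ d = 0 := by
    refine sum_eq_zero_of_involution (L.join p) (L.join_join p) (L.join_ne p) _ ?_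
    rintro (⟨y, k⟩ | j)
    · by_cases hy : y = x
      · simp [join, φ, hy]
      · have e1 := hf.2 (Sum.inl (y, k)) (by simp [hy])
        have e2 := hh.2 (Sum.inl (y, k)) (by simp [hy])
        simp only [join] at e1 e2
        simp [join, φ, hy, e1, e2]
    · have e1 := hf.2 (Sum.inr j) (by simp)
      have e2 := hh.2 (Sum.inr j) (by simp)
      simp only [join] at e1 e2
      simp [join, φ, e1, e2]
  have h3 : ∀ d, f d * h d = φ d +
      Sum.elim (fun y => if y.1 = x then f (Sum.inl y) * h (Sum.inl y) else 0) (fun _ => 0) d := by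
    rintro (⟨y, k⟩ | j)
    · by_cases hy : y = x <;> simp [φ, hy]
    · simp [φ]
  rw [Finset.sum_congr rfl fun d _ => h3 d, Finset.sum_add_distrib, h2, zero_add,
    Fintype.sum_sum_type, Fintype.sum_prod_type, Finset.sum_comm] at h1
  simpa using h1

open Classical in
/-- The number, `0` or `1`, of ways to have a single circle. -/
noncomputable def oneCircleIndicator (L : LinkCode X J) (p : X → Option Bool) : ZMod 2 :=
  if L.OneCircle p then 1 else 0

/-- With `x` removed the diagram is disconnected, so it carries a nonconstant invariant function.
Its values at the four ends have even sum, so some pairing preserves it. -/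
theorem exists_not_oneCircle [Fintype X] [Fintype J] [DecidableEq X] (L : LinkCode X J)
    (p : X → Option Bool) (x : X) : ∃ o, ¬ L.OneCircle (Function.update p x o) := by
  classical
  obtain ⟨f, h1, h2, a, b, hab⟩ := exists_not_constant_of_four_ends L.glue (L.join p) L.glue_glue
    (L.join_join p) (Finset.univ.image fun k : ZMod 4 => (Sum.inl (x, k) : (X × ZMod 4) ⊕ J))
    (by rw [Finset.card_image_of_injective _ fun k l h => by simpa using h]; rfl) (by
        rintro (⟨y, k⟩ | j) <;> simp [join])
  have hf : L.InvariantOff p x f := ⟨h1, fun d hd => h2 d (by simpa using fun k => (hd k).symm)⟩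
  obtain ⟨o, ho⟩ := exists_turn_invariant (fun k => f (Sum.inl (x, k)))
    (L.sum_mul_eq_zero_of_invariantOff p x f f hf hf)
  refine ⟨o, fun h => hab ?_⟩
  exact (L.oneCircle_update_iff p x o).1 h f hf ho a b

/-- The nonconstant functions witnessing two failures are orthogonal at the four ends, so one of
them is also invariant under the third pairing. -/
theorem not_oneCircle_third [Fintype X] [Fintype J] [DecidableEq X] (L : LinkCode X J)
    (p : X → Option Bool) (x : X) (o₁ o₂ o₃ : Option Bool) (h₁₂ : o₁ ≠ o₂)
    (h₁ : ¬ L.OneCircle (Function.update p x o₁)) (h₂ : ¬ L.OneCircle (Function.update p x o₂)) :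
    ¬ L.OneCircle (Function.update p x o₃) := by
  rw [oneCircle_update_iff] at h₁ h₂ ⊢
  push Not at h₁ h₂
  obtain ⟨f, hf, hf1, a, b, hab⟩ := h₁
  obtain ⟨h, hh, hh2, a', b', hab'⟩ := h₂
  intro H
  rcases turn_invariant_of_orthogonal _ _ (L.sum_mul_eq_zero_of_invariantOff p x f h hf hh)
    o₁ o₂ o₃ h₁₂ hf1 hh2 with e | e
  · exact hab (H f hf e a b)
  · exact hab' (H h hh e a' b')

/-- Modulo 2, the three ways of joining the darts at a crossing satisfy a skein relation. -/
theorem oneCircleIndicator_skein [Fintype X] [Fintype J] [DecidableEq X] (L : LinkCode X J)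
    (p : X → Option Bool) (x : X) :
    L.oneCircleIndicator (Function.update p x (some true)) +
      L.oneCircleIndicator (Function.update p x (some false)) =
      L.oneCircleIndicator (Function.update p x none) := by
  -- At least one pairing fails, and two failures force the third, so either none or exactly two of
  -- the three give a single circle.
  obtain ⟨o, ho⟩ := L.exists_not_oneCircle p x
  have h1 := L.not_oneCircle_third p x (some true) (some false) none (by decide)
  have h2 := L.not_oneCircle_third p x (some true) none (some false) (by decide)
  have h3 := L.not_oneCircle_third p x (some false) none (some true) (by decide)
  unfold oneCircleIndicator
  rcases o with _ | _ | _ <;> split_ifs <;> simp_all [zmod_two_add_self]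

/-- Induction on the set `Y` of split crossings: the terms for `T` and `insert a T` merge by the
skein relation at `a`. -/
theorem sum_powerset_oneCircleIndicator [Fintype X] [Fintype J] [DecidableEq X]
    (L : LinkCode X J) (Y : Finset X) :
    ∑ T ∈ Y.powerset, L.oneCircleIndicator
      (fun x => if x ∈ T then some true else if x ∈ Y then some false else none) =
      L.oneCircleIndicator fun _ => none := by
  induction Y using Finset.induction_on with
  | empty => simp
  | insert a Y ha ih =>
    rw [Finset.sum_powerset_insert ha, ← Finset.sum_add_distrib, ← ih]
    refine Finset.sum_congr rfl fun T hT => ?_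
    have haT : a ∉ T := fun h => ha (Finset.mem_powerset.1 hT h)
    have := L.oneCircleIndicator_skein
      (fun x => if x ∈ T then some true else if x ∈ Y then some false else none) a
    rw [add_comm] at this
    convert this using 2
    · congr 1; funext x
      by_cases hx : x = a <;> simp [hx, haT]
    · congr 1; funext x
      by_cases hx : x = a <;> simp [hx]
    · funext x
      by_cases hx : x = a <;> simp [hx, haT, ha]

/-- Modulo 2, the number of states with a single circle is `1` for knots and `0` for links
with more components. -/
theorem sum_oneCircleIndicator [Fintype X] [Fintype J] [DecidableEq X] (L : LinkCode X J) :
    ∑ σ : X → Bool, L.oneCircleIndicator (fun x => some (σ x)) =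
      L.oneCircleIndicator fun _ => none := by
  rw [← L.sum_powerset_oneCircleIndicator Finset.univ]
  refine Finset.sum_bij' (fun σ _ => Finset.univ.filter fun x => σ x = true)
    (fun T _ x => decide (x ∈ T)) (by simp) (by simp) (by intros; simp) (by intros; simp) ?_
  intro σ _
  congr 1; funext x
  cases h : σ x <;> simp [h]

end LinkCode

/-! ### Parity of one-circle states, by signs of permutations -/

instance : DecidableEq Hole
  | .outer, .outer => isTrue rfl
  | .outer, .inner => isFalse Hole.noConfusion
  | .inner, .outer => isFalse Hole.noConfusion
  | .inner, .inner => isTrue rfl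

instance : Fintype Hole := ⟨{.outer, .inner}, by rintro (_ | _) <;> decide⟩

/-- The sign of a transitive permutation. -/
theorem sign_of_transitive {α : Type*} [Fintype α] [DecidableEq α] [Nontrivial α]
    (π : Equiv.Perm α)
    (h : ∀ f : α → ZMod 2, (∀ a, f (π a) = f a) → ∀ a b, f a = f b) :
    Equiv.Perm.sign π = -(-1) ^ Fintype.card α := by
  classical
  have hs : ∀ a b, π.SameCycle a b := by
    intro a b
    have := h (fun d => if π.SameCycle a d then 1 else 0) (fun d => by
      simp only [Equiv.Perm.sameCycle_apply_right]) a b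
    by_contra hab
    simp [hab, Equiv.Perm.SameCycle.refl] at this
  have hm : ∀ a, π a ≠ a := by
    intro a ha
    obtain ⟨b, hb⟩ := exists_ne a
    exact hb ((hs a b).eq_of_left ha).symm
  obtain ⟨a, -, -⟩ := exists_pair_ne α
  have hc : π.IsCycle := ⟨a, hm a, fun b _ => hs a b⟩
  have hsupp : π.support = Finset.univ := by ext a; simp [hm a]
  rw [hc.sign, hsupp, Finset.card_univ]

/-- The composite of two involutions exchanging the colours `0` and `1`, on the points of
colour `0`. -/
def colorPerm {D : Type*} (c : D → ZMod 2) (g s : D → D) (hg : ∀ d, g (g d) = d)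
    (hs : ∀ d, s (s d) = d) (cg : ∀ d, c (g d) = c d + 1) (cs : ∀ d, c (s d) = c d + 1) :
    Equiv.Perm {d // c d = 0} where
  toFun d := ⟨s (g d), by rw [cs, cg, d.2]; rfl⟩
  invFun d := ⟨g (s d), by rw [cg, cs, d.2]; rfl⟩
  left_inv d := Subtype.ext (by simp [hs, hg])
  right_inv d := Subtype.ext (by simp [hs, hg])

/-- Colours alternate along a circle, so two steps at a time reach every point of colour 0 on it. A
single circle thus makes the permutation transitive. -/
theorem sign_colorPerm {D : Type*} [Fintype D] [DecidableEq D] (c : D → ZMod 2) (g s : D → D)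
    (hg : ∀ d, g (g d) = d) (hs : ∀ d, s (s d) = d) (cg : ∀ d, c (g d) = c d + 1)
    (cs : ∀ d, c (s d) = c d + 1) [Nontrivial {d // c d = 0}]
    (h : ∀ f : D → ZMod 2, (∀ d, f (g d) = f d) → (∀ d, f (s d) = f d) → ∀ a b, f a = f b) :
    Equiv.Perm.sign (colorPerm c g s hg hs cg cs) = -(-1) ^ Fintype.card {d // c d = 0} := by
  refine sign_of_transitive _ fun f hf a b => ?_
  have two : ∀ z : ZMod 2, z ≠ 0 → z + 1 = 0 := by decide
  have two' : ∀ z : ZMod 2, z = 0 → z + 1 ≠ 0 := by decide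
  -- Extend `f` to the other colour along `g`; invariance under `s` is then invariance of `f` under
  -- the permutation.
  let F : D → ZMod 2 := fun d =>
    if hd : c d = 0 then f ⟨d, hd⟩ else f ⟨g d, by rw [cg]; exact two _ hd⟩
  have h0 : ∀ d (hd : c d = 0), F d = f ⟨d, hd⟩ := fun d hd => dif_pos hd
  have h1 : ∀ d (hd : c d ≠ 0), F d = f ⟨g d, by rw [cg]; exact two _ hd⟩ := fun d hd => dif_neg hd
  have hF := h F (fun d => ?_) (fun d => ?_) a b
  · rwa [h0 _ a.2, h0 _ b.2] at hF
  · by_cases hd : c d = 0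
    · rw [h0 d hd, h1 (g d) (by rw [cg]; exact two' _ hd)]
      simp only [hg]
    · rw [h1 d hd, h0 (g d) (by rw [cg]; exact two _ hd)]
  · by_cases hd : c d = 0
    · rw [h0 d hd, h1 (s d) (by rw [cs]; exact two' _ hd), ← hf]
      congr 1
      simp [colorPerm, hg, hs]
    · rw [h1 d hd, h0 (s d) (by rw [cs]; exact two _ hd), ← hf ⟨g d, _⟩]
      congr 1
      simp [colorPerm, hg]

theorem alternating_turn (f : ZMod 4 → ZMod 2) (hf : ∀ k, f (k + 1) = f k + 1) (b : Bool)
    (k : ZMod 4) : f (turn (some b) k) = f k + 1 := by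
  revert f b k; decide

theorem alternating_add_two (f : ZMod 4 → ZMod 2) (hf : ∀ k, f (k + 1) = f k + 1) (k : ZMod 4) :
    f (k + 2) = f k := by
  revert f k; decide

theorem exists_alternating_eq_zero (f : ZMod 4 → ZMod 2) (hf : ∀ k, f (k + 1) = f k + 1) :
    ∃ k, f k = 0 := by
  revert f; decide

theorem alternating_eq (f : ZMod 4 → ZMod 2) (hf : ∀ k, f (k + 1) = f k + 1) (k l : ZMod 4)
    (h : f k = f l) : l = k ∨ l = k + 2 := by
  revert f k l; decide

theorem eq_of_add_one_eq {α : Type*} (f : ZMod 4 → α) (hf : ∀ k, f (k + 1) = f k) (k l : ZMod 4) :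
    f k = f l := by
  have h : ∀ n : ℕ, ∀ k, f (k + n) = f k := by
    intro n
    induction n with
    | zero => simp
    | succ n ih => intro k; rw [Nat.cast_succ, ← add_assoc, hf, ih]
  have := h (l - k).val k
  rw [ZMod.natCast_zmod_val] at this
  rw [← this]
  congr 1
  ring

namespace SphericalTangle

variable {X J : Type*}

/-- The darts at the crossings and at the boundary circles. -/
def fourDart : X ⊕ Hole → ZMod 4 → SDart X J
  | Sum.inl x, k => Sum.inl (x, k)
  | Sum.inr h, k => Sum.inr (Sum.inr (h, k))

theorem fourDart_inj {y y' : X ⊕ Hole} {k k' : ZMod 4} :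
    (fourDart y k : SDart X J) = fourDart y' k' ↔ y = y' ∧ k = k' := by
  rcases y with x | h <;> rcases y' with x' | h' <;> simp [fourDart]

theorem sDart_cases {P : SDart X J → Prop} (h4 : ∀ y k, P (fourDart y k))
    (h2 : ∀ j, P (Sum.inr (Sum.inl j))) (d : SDart X J) : P d := by
  rcases d with ⟨x, k⟩ | j | ⟨h, k⟩
  · exact h4 (Sum.inl x) k
  · exact h2 j
  · exact h4 (Sum.inr h) k

/-- How the darts are joined if the crossings and the boundary circles are split along `τ`. -/
def splitAll (S : SphericalTangle X J) (τ : X ⊕ Hole → Bool) : SDart X J → SDart X J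
  | Sum.inl (x, k) => Sum.inl (x, turn (some (τ (Sum.inl x))) k)
  | Sum.inr (Sum.inl j) => Sum.inr (Sum.inl (S.pass j))
  | Sum.inr (Sum.inr (h, k)) => Sum.inr (Sum.inr (h, turn (some (τ (Sum.inr h))) k))

theorem splitAll_fourDart (S : SphericalTangle X J) (τ : X ⊕ Hole → Bool) (y : X ⊕ Hole)
    (k : ZMod 4) : S.splitAll τ (fourDart y k) = fourDart y (turn (some (τ y)) k) := by
  rcases y with x | h <;> rfl

theorem splitAll_splitAll (S : SphericalTangle X J) (τ : X ⊕ Hole → Bool) (d : SDart X J) :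
    S.splitAll τ (S.splitAll τ d) = d := by
  induction d using sDart_cases with
  | h4 y k => rw [splitAll_fourDart, splitAll_fourDart, turn_turn]
  | h2 j => simp [splitAll, S.pass_pass]

theorem splitAll_ne (S : SphericalTangle X J) (τ : X ⊕ Hole → Bool) (d : SDart X J) :
    S.splitAll τ d ≠ d := by
  induction d using sDart_cases with
  | h4 y k => rw [splitAll_fourDart, Ne, fourDart_inj]; exact fun h => turn_ne _ _ h.2
  | h2 j => simpa [splitAll] using S.pass_ne j

theorem nextDart_bijective [Finite X] [Finite J] (S : SphericalTangle X J) :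
    Function.Bijective (nextDart (X := X) S.pass) := by
  apply Finite.injective_iff_bijective.1
  have hp : Function.Injective S.pass := (show Function.Involutive S.pass from S.pass_pass).injective
  rintro (⟨x, k⟩ | j | ⟨_ | _, k⟩) (⟨x', k'⟩ | j' | ⟨_ | _, k'⟩) <;>
    simp [nextDart, hp.eq_iff]

/-- The faces of a spherical tangle diagram have a checkerboard colouring. -/
theorem exists_coloring [Fintype X] [Fintype J] (S : SphericalTangle X J) :
    ∃ c : SDart X J → ZMod 2, (∀ d, c (S.glue d) = c d + 1) ∧
      (∀ j, c (Sum.inr (Sum.inl (S.pass j))) = c (Sum.inr (Sum.inl j)) + 1) ∧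
      ∀ y k, c (fourDart y (k + 1)) = c (fourDart y k) + 1 := by
  obtain ⟨c, h1, h2⟩ := exists_checkerboard (nextDart S.pass) S.glue S.nextDart_bijective
    S.glue_glue S.glue_ne (fun h hn => by
      -- Any fixed-point-free pairing of darts within each vertex serves here; the B-splitting is
      -- one.
      refine sum_eq_zero_of_involution (S.splitAll fun _ => false) (S.splitAll_splitAll _)
        (S.splitAll_ne _) h ?_
      have key : ∀ y k l, h (fourDart y k) = h (fourDart y l) := by
        rintro (x | _ | _) k l
        · exact eq_of_add_one_eq (fun k => h (fourDart (Sum.inl x) k))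
            (fun k => hn (Sum.inl (x, k))) k l
        · refine eq_of_add_one_eq (fun k => h (fourDart (Sum.inr Hole.outer) k))
            (fun k => ?_) k l
          have := hn (Sum.inr (Sum.inr (Hole.outer, k + 1)))
          simp only [nextDart, add_sub_cancel_right] at this
          exact this.symm
        · exact eq_of_add_one_eq (fun k => h (fourDart (Sum.inr Hole.inner) k))
            (fun k => hn (Sum.inr (Sum.inr (Hole.inner, k)))) k l
      intro d
      induction d using sDart_cases with
      | h4 y k => rw [splitAll_fourDart]; exact key _ _ _
      | h2 j => exact hn (Sum.inr (Sum.inl j))) S.planar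
  refine ⟨c, h2, fun j => h1 (Sum.inr (Sum.inl j)), ?_⟩
  rintro (x | _ | _) k
  · exact h1 (Sum.inl (x, k))
  · have := h1 (Sum.inr (Sum.inr (Hole.outer, k + 1)))
    simp only [nextDart, add_sub_cancel_right] at this
    simp only [fourDart, this, add_assoc, zmod_two_add_self, add_zero]
  · exact h1 (Sum.inr (Sum.inr (Hole.inner, k)))

/-- The darts form a single circle if the crossings and the boundary circles are split
along `τ`. -/
def OneCircle (S : SphericalTangle X J) (τ : X ⊕ Hole → Bool) : Prop :=
  ∀ f : SDart X J → ZMod 2, (∀ d, f (S.glue d) = f d) → (∀ d, f (S.splitAll τ d) = f d) →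
    ∀ a b, f a = f b

/-- The numbers of A-type splittings in any two states with a single circle have the same
parity. -/
theorem exists_sign_of_oneCircle [Fintype X] [Fintype J] (S : SphericalTangle X J) :
    ∃ ε : ℤˣ, ∀ τ, S.OneCircle τ → ∏ y, (if τ y = true then (-1 : ℤˣ) else 1) = ε := by
  classical
  obtain ⟨c, cg, cp, c4⟩ := S.exists_coloring
  have cs : ∀ τ d, c (S.splitAll τ d) = c d + 1 := by
    intro τ d
    induction d using sDart_cases with
    | h4 y k =>
      rw [splitAll_fourDart]
      exact alternating_turn (fun k => c (fourDart y k)) (c4 y) (τ y) k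
    | h2 j => exact cp j
  let π : (X ⊕ Hole → Bool) → Equiv.Perm {d // c d = 0} := fun τ =>
    colorPerm c S.glue (S.splitAll τ) S.glue_glue (S.splitAll_splitAll τ) cg (cs τ)
  -- The two splittings send `l` to `1 - l` and to `3 - l`, which differ by 2; so switching at `y`
  -- swaps the two darts of colour 0 there.
  have hstep : ∀ (T : Finset (X ⊕ Hole)) (y : X ⊕ Hole), y ∉ T →
      Equiv.Perm.sign (π fun z => decide (z ∈ insert y T)) =
        -Equiv.Perm.sign (π fun z => decide (z ∈ T)) := by
    intro T y hy
    obtain ⟨k, hk⟩ := exists_alternating_eq_zero (fun k => c (fourDart y k)) (c4 y)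
    have hk2 : c (fourDart y (k + 2)) = 0 :=
      (alternating_add_two (fun k => c (fourDart y k)) (c4 y) k).trans hk
    let a : {d // c d = 0} := ⟨fourDart y k, hk⟩
    let b : {d // c d = 0} := ⟨fourDart y (k + 2), hk2⟩
    have hab : a ≠ b := by
      intro h
      have h' := (fourDart_inj.1 (congrArg Subtype.val h)).2
      have : ∀ k : ZMod 4, k ≠ k + 2 := by decide
      exact this k h'
    have hmul : (π fun z => decide (z ∈ insert y T)) =
        Equiv.swap a b * π fun z => decide (z ∈ T) := by
      ext d
      obtain ⟨e, he⟩ : ∃ e, e = S.glue d.1 := ⟨_, rfl⟩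
      have hd : ∀ τ, (π τ d).1 = S.splitAll τ e := fun τ => by rw [he]; rfl
      rw [Equiv.Perm.mul_apply, hd]
      have hd' := hd fun z => decide (z ∈ T)
      generalize (π fun z => decide (z ∈ T)) d = w at hd'
      clear hd he
      have far : w ≠ a → w ≠ b → (Equiv.swap a b w).1 = w.1 := fun h1 h2 => by
        rw [Equiv.swap_apply_of_ne_of_ne h1 h2]
      induction e using sDart_cases with
      | h4 z l =>
        rw [splitAll_fourDart] at hd' ⊢
        by_cases hz : z = y
        · subst hz
          have e1 : turn (some (decide (z ∈ T))) l = 1 - l := by simp [hy, turn, pairing01]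
          have e2 : turn (some (decide (z ∈ insert z T))) l = (1 - l) + 2 := by
            simp only [Finset.mem_insert_self, decide_true, turn, pairing12]
            ring
          rw [e1] at hd'
          rw [e2]
          have h0 : c (fourDart z k) = c (fourDart z (1 - l)) := by rw [hk, ← hd', w.2]
          rcases alternating_eq (fun k => c (fourDart z k)) (c4 z) _ _ h0 with h | h
          · have : w = a := Subtype.ext (by rw [hd', h])
            rw [this, Equiv.swap_apply_left, h]
          · have : w = b := Subtype.ext (by rw [hd', h])
            have four : ∀ k : ZMod 4, k + 2 + 2 = k := by decide
            rw [this, Equiv.swap_apply_right, h, four k]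
        · rw [far, hd']
          · simp [hz]
          · intro h; rw [h] at hd'; exact hz (fourDart_inj.1 hd').1.symm
          · intro h; rw [h] at hd'; exact hz (fourDart_inj.1 hd').1.symm
      | h2 j =>
        rw [far, hd']
        · rfl
        · intro h; rw [h] at hd'; rcases y with y | y <;> simp [a, fourDart, splitAll] at hd'
        · intro h; rw [h] at hd'; rcases y with y | y <;> simp [b, fourDart, splitAll] at hd'
    rw [hmul, Equiv.Perm.sign_mul, Equiv.Perm.sign_swap hab, neg_one_mul]
  have hsign : ∀ T : Finset (X ⊕ Hole), Equiv.Perm.sign (π fun z => decide (z ∈ T)) =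
      (-1) ^ T.card * Equiv.Perm.sign (π fun _ => false) := by
    intro T
    induction T using Finset.induction_on with
    | empty => simp
    | insert y T hy ih => rw [hstep T y hy, ih, Finset.card_insert_of_notMem hy, pow_succ]; simp
  -- Each of the two boundary circles contributes a dart of colour 0.
  have : Nontrivial {d // c d = 0} := by
    obtain ⟨k, hk⟩ :=
      exists_alternating_eq_zero (fun k => c (fourDart (Sum.inr Hole.outer) k)) (c4 _)
    obtain ⟨l, hl⟩ :=
      exists_alternating_eq_zero (fun k => c (fourDart (Sum.inr Hole.inner) k)) (c4 _)
    refine ⟨⟨_, hk⟩, ⟨_, hl⟩, fun h => ?_⟩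
    have h' : (fourDart (Sum.inr Hole.outer) k : SDart X J) = fourDart (Sum.inr Hole.inner) l :=
      congrArg Subtype.val h
    simpa using (fourDart_inj.1 h').1
  refine ⟨-(-1) ^ Fintype.card {d // c d = 0} * (Equiv.Perm.sign (π fun _ => false))⁻¹,
    fun τ hτ => ?_⟩
  rw [eq_mul_inv_iff_mul_eq, ← sign_colorPerm c S.glue (S.splitAll τ) S.glue_glue
    (S.splitAll_splitAll τ) cg (cs τ) hτ]
  have := hsign (Finset.univ.filter fun y => τ y = true)
  simp only [Finset.mem_filter, Finset.mem_univ, true_and, Bool.decide_eq_true] at this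
  rw [Finset.prod_ite, Finset.prod_const, Finset.prod_const_one, mul_one]
  exact this.symm

end SphericalTangle

/-! ### The bracket as a sum over one-circle states -/

namespace LinkCode

variable {X J : Type*}

theorem circles_eq_one_iff (L : LinkCode X J) [Finite X] [Finite J]
    [Nonempty ((X × ZMod 4) ⊕ J)] (σ : X → Bool) :
    L.circles σ = 1 ↔ L.OneCircle fun x => some (σ x) := by
  classical
  rw [circles, orbitCount₂, Nat.card_eq_one_iff_unique]
  constructor
  · rintro ⟨hs, -⟩ f h1 h2 a b
    rw [join_some] at h2
    let q : (Quot fun a b => b = L.glue a ∨ b = L.split σ a) → ZMod 2 := Quot.lift f (by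
      rintro a b (rfl | rfl)
      · exact (h1 a).symm
      · exact (h2 a).symm)
    exact congrArg q (Subsingleton.elim (Quot.mk _ a) (Quot.mk _ b))
  · intro h
    refine ⟨⟨?_⟩, ⟨Quot.mk _ (Classical.arbitrary _)⟩⟩
    rintro ⟨a⟩ ⟨b⟩
    by_contra hab
    have := h (fun d => if Quot.mk (fun a b => b = L.glue a ∨ b = L.split σ a) d =
      Quot.mk _ a then 1 else 0) (fun d => ?_) (fun d => ?_) a b
    · simp [Ne.symm hab] at this
    · rw [show Quot.mk (fun a b => b = L.glue a ∨ b = L.split σ a) (L.glue d) = Quot.mk _ d from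
        by symm; apply Quot.sound; exact Or.inl rfl]
    · rw [join_some, show Quot.mk (fun a b => b = L.glue a ∨ b = L.split σ a) (L.split σ d) =
        Quot.mk _ d from by symm; apply Quot.sound; exact Or.inr rfl]

theorem circles_pos (L : LinkCode X J) [Finite X] [Finite J]
    [Nonempty ((X × ZMod 4) ⊕ J)] (σ : X → Bool) : 0 < L.circles σ := by
  rw [circles, orbitCount₂]
  have : Nonempty (Quot fun a b => b = L.glue a ∨ b = L.split σ a) :=
    ⟨Quot.mk _ (Classical.arbitrary _)⟩
  exact Nat.card_pos

open Classical in
/-- The bracket at a primitive eighth root of unity counts the states with a single circle. -/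
theorem bracket_eq_sum [Fintype X] [Finite J] [Nonempty ((X × ZMod 4) ⊕ J)] (L : LinkCode X J)
    (A : ℂ) (hA : A ^ 2 = Complex.I) :
    L.bracket A = A⁻¹ ^ Fintype.card X * ∑ σ : X → Bool,
      if L.OneCircle fun x => some (σ x) then
        Complex.I ^ (Finset.univ.filter fun x => σ x = true).card else 0 := by
  have hA0 : A ≠ 0 := by
    rintro rfl
    exact Complex.I_ne_zero (by simpa using hA.symm)
  have hδ : -A ^ 2 - A⁻¹ ^ 2 = 0 := by
    rw [inv_pow, hA]; simp
  rw [bracket, Finset.mul_sum]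
  refine Finset.sum_congr rfl fun σ _ => ?_
  rw [hδ, ← L.circles_eq_one_iff]
  have hpos := L.circles_pos σ
  split_ifs with h
  · have hc : (Finset.univ.filter fun x => σ x = true).card +
        (Finset.univ.filter fun x => σ x = false).card = Fintype.card X := by
      have := Finset.card_filter_add_card_filter_not (s := Finset.univ) fun x => σ x = true
      simpa using this
    -- With `α + β = n`, `A^α A^{-β} = A^{-n} A^{2α}`, and `A^2 = i`.
    rw [h, ← hc, ← hA, pow_add, ← pow_mul]
    simp only [le_refl, tsub_eq_zero_of_le, pow_zero, mul_one, inv_pow]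
    field_simp
    ring
  -- The count is positive and not 1, so the truncated exponent `d - 1` is nonzero and the `0^0`
  -- convention plays no role.
  · rw [zero_pow (by omega), mul_zero, mul_zero]

end LinkCode

/-! ### Closures and evenness of the matrix -/

namespace SphericalTangle

variable {X J : Type*}

/-- The splittings of the boundary circles that give the closure `S_{ij}`. -/
def closingState (i j : Fin 2) : Hole → Bool
  | .outer => decide (i ≠ 0)
  | .inner => decide (j = 0)

theorem close_split (S : SphericalTangle X J) (i j : Fin 2) (σ : X → Bool) :
    (S.close i j).split σ = S.splitAll (Sum.elim σ (closingState i j)) := by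
  funext d
  rcases d with ⟨x, k⟩ | j' | ⟨_ | _, k⟩
  · simp only [LinkCode.split, splitAll, Sum.elim_inl]
    cases σ x <;> rfl
  · rfl
  · fin_cases i <;> rfl
  · fin_cases j <;> rfl

theorem oneCircle_close_iff (S : SphericalTangle X J) (i j : Fin 2) (σ : X → Bool) :
    ((S.close i j).OneCircle fun x => some (σ x)) ↔
      S.OneCircle (Sum.elim σ (closingState i j)) := by
  rw [LinkCode.OneCircle, LinkCode.join_some, close_split]
  rfl

/-- A closure of a tangle with a closed component is not a knot. -/
theorem not_oneCircle_none (S : SphericalTangle X J)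
    (hS : ∃ c : S.Component, Component.IsClosed S c) (i j : Fin 2) :
    ¬ (S.close i j).OneCircle fun _ => none := by
  classical
  obtain ⟨⟨d⟩, hc⟩ := hS
  intro h
  have hg : ∀ a, S.component (S.glue a) = S.component a := fun a => by
    symm; apply Quot.sound; exact Or.inl rfl
  have ht : ∀ a, S.component (S.through a) = S.component a := fun a => by
    symm; apply Quot.sound; exact Or.inr rfl
  -- The indicator of the closed component vanishes at every endpoint, so the closing arcs preserve
  -- it.
  have := h (fun a => if S.component a = S.component d then 1 else 0) (fun a => ?_) ?_ d
    (Sum.inr (Sum.inr (Hole.outer, 0)))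
  · have hne := hc (Hole.outer, 0)
    change S.component _ ≠ S.component d at hne
    simp [hne] at this
  · change (if S.component (S.glue a) = _ then (1 : ZMod 2) else 0) = _
    rw [hg]
  · rintro (⟨x, k⟩ | j' | e)
    · have e := ht (Sum.inl (x, k))
      change (if S.component (S.through (Sum.inl (x, k))) = _ then (1 : ZMod 2) else 0) = _
      rw [e]
    · have e := ht (Sum.inr (Sum.inl j'))
      change (if S.component (S.through (Sum.inr (Sum.inl j'))) = _ then (1 : ZMod 2) else 0) = _
      rw [e]
    · have h1 := hc e
      have h2 := hc (closing i j e)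
      change S.component _ ≠ S.component d at h1 h2
      change (if S.component (Sum.inr (Sum.inr (closing i j e))) = _ then (1 : ZMod 2) else 0) = _
      simp [h1, h2]

theorem I_pow_cases (n : ℕ) : ((-1 : ℤˣ) ^ n = 1 ∧ (Complex.I ^ n = 1 ∨ Complex.I ^ n = -1)) ∨
    ((-1 : ℤˣ) ^ n = -1 ∧ (Complex.I ^ n = Complex.I ∨ Complex.I ^ n = -Complex.I)) := by
  induction n with
  | zero => simp
  | succ n ih =>
    rw [pow_succ, pow_succ]
    rcases ih with ⟨h1, h2 | h2⟩ | ⟨h1, h2 | h2⟩ <;> rw [h1, h2] <;> simp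

/-- The factors by which the brackets of the closures are multiplied in the matrix. -/
noncomputable def phase (i j : Fin 2) : ℂ := !![1, -Complex.I; Complex.I, 1] i j

theorem bracketMatrix_apply [Fintype X] (S : SphericalTangle X J) (i j : Fin 2) :
    S.bracketMatrix i j = phase i j * S.closureBracket i j := by
  fin_cases i <;> fin_cases j <;> simp [bracketMatrix, phase]
  rw [← mul_assoc, Complex.I_mul_I, neg_one_mul, neg_neg]

theorem exp_pi_div_four_sq : Complex.exp (Real.pi / 4 * Complex.I) ^ 2 = Complex.I := by
  rw [← Complex.exp_nat_mul, show ((2 : ℕ) : ℂ) * (Real.pi / 4 * Complex.I) =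
    Real.pi / 2 * Complex.I by push_cast; ring, Complex.exp_pi_div_two_mul_I]

theorem exists_even_bracketMatrix [Fintype X] [Fintype J] (S : SphericalTangle X J)
    (hS : ∃ c : S.Component, Component.IsClosed S c) :
    ∃ (u : ℂ) (N : Matrix (Fin 2) (Fin 2) ℤ), u ^ 8 = 1 ∧
      S.bracketMatrix = u • N.map (Int.cast : ℤ → ℂ) ∧ ∀ i j, (2 : ℤ) ∣ N i j := by
  classical
  obtain ⟨ε, hε⟩ := S.exists_sign_of_oneCircle
  set A := Complex.exp (Real.pi / 4 * Complex.I)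
  have hA2 : A ^ 2 = Complex.I := exp_pi_div_four_sq
  have hA8 : A ^ 8 = 1 := by
    rw [show 8 = 2 * 4 from rfl, pow_mul, hA2, Complex.I_pow_four]
  -- For `S₁₁` the closings contribute one A-splitting, so `ε = 1` forces `α(σ)` odd and `i^α = ±i`;
  -- the phases give the same unit, up to sign, in the other entries.
  let w : ℂ := if ε = 1 then Complex.I else 1
  have hw8 : w ^ 8 = 1 := by
    have : Complex.I ^ 8 = 1 := by rw [show 8 = 4 * 2 from rfl, pow_mul, Complex.I_pow_four, one_pow]
    by_cases h : ε = 1 <;> simp [w, h, this]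
  have hterm : ∀ (i j : Fin 2) (σ : X → Bool), ∃ e : ℤ, (phase i j * if (S.close i j).OneCircle fun x => some (σ x) then
      Complex.I ^ (Finset.univ.filter fun x => σ x = true).card else 0) = w * e ∧
      (e : ZMod 2) = (S.close i j).oneCircleIndicator fun x => some (σ x) := by
    intro i j σ
    unfold LinkCode.oneCircleIndicator
    split_ifs with h
    · have hs := hε _ ((S.oneCircle_close_iff i j σ).1 h)
      rw [Fintype.prod_sum_type, show (Finset.univ : Finset Hole) = {.outer, .inner} from rfl,
        Finset.prod_pair (by decide)] at hs
      replace hs : (∏ x, if σ x = true then (-1 : ℤˣ) else 1) *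
          ((if closingState i j .outer = true then -1 else 1) *
            if closingState i j .inner = true then -1 else 1) = ε := hs
      rw [Finset.prod_ite, Finset.prod_const, Finset.prod_const_one, mul_one] at hs
      suffices H : phase i j * Complex.I ^ (Finset.univ.filter fun x => σ x = true).card = w ∨
          phase i j * Complex.I ^ (Finset.univ.filter fun x => σ x = true).card = -w by
        rcases H with H | H
        · exact ⟨1, by simp [H], by simp⟩
        · exact ⟨-1, by simp [H], by decide⟩
      have hne : (-1 : ℤˣ) ≠ 1 := by decide
      subst hs
      rcases I_pow_cases (Finset.univ.filter fun x => σ x = true).card with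
        ⟨h1, h2 | h2⟩ | ⟨h1, h2 | h2⟩ <;> simp only [w, h1, h2] <;>
        fin_cases i <;> fin_cases j <;> simp [phase, closingState, hne]
    · exact ⟨0, by simp, by simp⟩
  choose e he he2 using hterm
  refine ⟨A⁻¹ ^ Fintype.card X * w, fun i j => ∑ σ, e i j σ, ?_, ?_, fun i j => ?_⟩
  · rw [mul_pow, hw8, mul_one, ← pow_mul, mul_comm, pow_mul, inv_pow, hA8, inv_one, one_pow]
  · ext i j
    have : Nonempty ((X × ZMod 4) ⊕ (J ⊕ (Hole × ZMod 4))) :=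
      ⟨Sum.inr (Sum.inr (Hole.outer, 0))⟩
    rw [bracketMatrix_apply, closureBracket, LinkCode.bracket_eq_sum _ A hA2, mul_left_comm,
      Finset.mul_sum, Finset.sum_congr rfl fun σ _ => he i j σ, ← Finset.mul_sum]
    rw [← Int.cast_sum, ← mul_assoc]
    rfl
  · rw [← Int.modEq_zero_iff_dvd, ← Int.cast_zero]
    have h1 : ((∑ σ, e i j σ : ℤ) : ZMod 2) = 0 := by
      rw [Int.cast_sum, Finset.sum_congr rfl fun σ _ => he2 i j σ,
        LinkCode.sum_oneCircleIndicator, LinkCode.oneCircleIndicator,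
        if_neg (S.not_oneCircle_none hS i j)]
    exact Int.modEq_zero_iff_dvd.2 ((ZMod.intCast_zmod_eq_zero_iff_dvd _ 2).1 h1)

end SphericalTangle

/-! ### Uniqueness up to sign -/

/-- The integer matrices that are multiples of `N` by an eighth root of unity. -/
theorem eighth_root_multiples (N : Matrix (Fin 2) (Fin 2) ℤ) :
    {M : Matrix (Fin 2) (Fin 2) ℤ | ∃ z : ℂ, z ^ 8 = 1 ∧
      M.map (Int.cast : ℤ → ℂ) = z • N.map (Int.cast : ℤ → ℂ)} = projClass N := by
  ext M
  simp only [Set.mem_ofPred_eq, projClass, Set.mem_insert_iff, Set.mem_singleton_iff]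
  constructor
  · rintro ⟨z, hz, h⟩
    have hij : ∀ i j, (M i j : ℂ) = z * N i j := fun i j => by
      simpa using congrFun (congrFun h i) j
    by_cases hN : N = 0
    · left
      ext i j
      have := hij i j
      rw [hN] at this ⊢
      simpa using this
    · obtain ⟨i, j, hne⟩ : ∃ i j, N i j ≠ 0 := by
        by_contra! h0
        exact hN (Matrix.ext h0)
      have hne' : (N i j : ℂ) ≠ 0 := by exact_mod_cast hne
      -- Integers with equal eighth powers agree up to sign, so one nonzero entry forces `z = 1` or
      -- `z = -1`.
      have h8 : (M i j) ^ 8 = (N i j) ^ 8 := by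
        have : (M i j : ℂ) ^ 8 = (N i j : ℂ) ^ 8 := by rw [hij, mul_pow, hz, one_mul]
        exact_mod_cast this
      rcases pow_eq_pow_iff_cases.1 h8 |>.resolve_left (by decide) with e | ⟨e, -⟩
      · have : z = 1 := by
          have := hij i j
          rw [e] at this
          exact (mul_eq_right₀ hne').1 this.symm
        left
        ext a b
        have := hij a b
        simp_all
      · have : z = -1 := by
          have := hij i j
          rw [e, Int.cast_neg] at this
          apply mul_right_cancel₀ hne'
          rw [← this, neg_one_mul]
        right
        ext a b
        have h' := hij a b
        rw [this, neg_one_mul] at h'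
        exact_mod_cast h'
  · rintro (rfl | rfl)
    · exact ⟨1, by simp, by simp⟩
    · exact ⟨-1, by norm_num, by ext; simp⟩

theorem SphericalTangle.invariant_eq_projClass {X J : Type*} [Fintype X] (S : SphericalTangle X J)
    (u : ℂ) (N : Matrix (Fin 2) (Fin 2) ℤ) (hu : u ^ 8 = 1)
    (h : S.bracketMatrix = u • N.map (Int.cast : ℤ → ℂ)) : S.invariant = projClass N := by
  have hu0 : u ≠ 0 := by rintro rfl; norm_num at hu
  rw [← eighth_root_multiples]
  ext M
  simp only [SphericalTangle.invariant, Set.mem_ofPred_eq, h, smul_smul]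
  constructor
  · rintro ⟨z, hz, e⟩
    exact ⟨z * u, by rw [mul_pow, hz, hu, one_mul], e⟩
  · rintro ⟨z, hz, e⟩
    exact ⟨z * u⁻¹, by rw [mul_pow, inv_pow, hz, hu, inv_one, one_mul],
      by rw [mul_assoc, inv_mul_cancel₀ hu0, mul_one, e]⟩

theorem theorem4p28 {X J : Type*} [Fintype X] [Fintype J] (S : SphericalTangle X J)
    (hS : ∃ c : S.Component, SphericalTangle.Component.IsClosed S c) :
    (∃ M : Matrix (Fin 2) (Fin 2) ℤ, S.invariant = projClass M) ∧
      ∀ α β γ δ : ℤ, S.invariant = projClass !![α, γ; β, δ] →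
        α ≡ 0 [ZMOD 2] ∧ β ≡ 0 [ZMOD 2] ∧ γ ≡ 0 [ZMOD 2] ∧ δ ≡ 0 [ZMOD 2] := by
  obtain ⟨u, N, hu, hN, heven⟩ := S.exists_even_bracketMatrix hS
  have hinv := S.invariant_eq_projClass u N hu hN
  refine ⟨⟨N, hinv⟩, fun α β γ δ h => ?_⟩
  have hM : !![α, γ; β, δ] ∈ projClass N := by
    rw [← hinv, h]
    exact Or.inl rfl
  have key : ∀ i j, (2 : ℤ) ∣ !![α, γ; β, δ] i j := by
    intro i j
    rcases hM with e | e <;> rw [e]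
    · exact heven i j
    · exact (heven i j).neg_right
  simp only [Int.modEq_zero_iff_dvd]
  exact ⟨key 0 0, key 1 0, key 0 1, key 1 1⟩
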